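/- **Theorem (number of edges of $\mathsf{DP}(n)$).** The degree partition of a simple graph on the vertex set $\{1,\dots,n\}$ is the vector in $\mathbb{R}^n$ obtained by rearranging its degree sequence in weakly decreasing order (zero entries are allowed). Let $\mathsf{DP}(n)\subset\mathbb{R}^n$ be the convex hull of all degree partitions of simple graphs on $\{1,\dots,n\}$. For every integer $n\ge 3$, the polytope $\mathsf{DP}(n)$ has exactly $2^{n-2}(2n-3)$ edges (one-dimensional faces). -/

import Mathlib

open Classical in
/-- The degree sequence of a simple graph on the vertex set `Fin n`. -/
noncomputable def degreeSequence {n : ℕ} (G : SimpleGraph (Fin n)) : Fin n → ℕ :=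
  fun i => G.degree i

/-- `d` is the degree partition of `G`: the rearrangement of the degree sequence of `G`
in weakly decreasing order. -/
def IsDegreePartition {n : ℕ} (G : SimpleGraph (Fin n)) (d : Fin n → ℕ) : Prop :=
  Antitone d ∧ ∃ σ : Equiv.Perm (Fin n), d = degreeSequence G ∘ σ

/-- The set of all degree partitions of simple graphs on `n` vertices. -/
def degreePartitions (n : ℕ) : Set (Fin n → ℕ) :=
  {d | ∃ G : SimpleGraph (Fin n), IsDegreePartition G d}

/-- The polytope of degree partitions: the convex hull in `ℝⁿ` of all degree partitions of
simple graphs on `n` vertices. -/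
def degreePartitionPolytope (n : ℕ) : Set (Fin n → ℝ) :=
  convexHull ℝ ((fun (d : Fin n → ℕ) (i : Fin n) => (d i : ℝ)) '' degreePartitions n)

/-- The edges of a polytope `P` in `ℝⁿ`: its faces (sets of maximizers over `P` of a linear
functional) of affine dimension one. The empty set has `vectorSpan` of rank zero, so it is
not counted. -/
def polytopeEdges {n : ℕ} (P : Set (Fin n → ℝ)) : Set (Set (Fin n → ℝ)) :=
  {F | IsExposed ℝ P F ∧ Module.finrank ℝ (vectorSpan ℝ F) = 1}

/-!
Every linear functional `a` is maximal over the degree sequences at the threshold graphs of `a`: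
put an edge `ij` when `a i + a j > 0`, none when `a i + a j < 0`, and decide the ties
`a i + a j = 0` freely. To maximize over `DP(n)` one may replace the functional by its projection
onto the cone of antitone vectors. The points of the corresponding face lie between the two extreme
threshold vertices, all ties off and all ties on, and switching on a single level `|a i|` of ties
also gives a point of the face. If the face is an edge, this point must be an endpoint, so there is
exactly one level, and the edge is the segment between the two extreme vertices. Conversely, if `a`
is antitone with exactly one level of ties, that segment is cut out by `a` together with the
inequalities `x i ≥ x j` for `a i = a j`, `i ≤ j`, hence is an edge.

It remains to count the pairs of extreme degree multisets. If the weight of largest absolute value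
takes part in no tie, its vertex is dominating or isolated in both graphs and can be deleted, and
the two cases are told apart by the degrees. This gives `E(n) = 2 E(n - 1) + T(n)`, where `T(n)`
counts the pairs with a tie at the outermost level. Without ties the same recursion gives
`2 ^ (m - 1)` tie-free pairs of `m` weights, and an outermost tie is described by the tie-free pair
of the `m` inner weights and the numbers `p, q ≥ 1` of weights `t` and `-t`, or is the tie of all
weights at level `0`. So `T(n) = 2 ^ (n - 1)` for `n ≥ 3`, and `E(2) = 1`.
-/

section ThresholdGraph

/-- Threshold adjacency of two weights: their sum is positive, or it is a *tie* (the sum is zero)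
whose level `|x| = |y|` belongs to the set `T` of switched-on levels. -/
def ThresholdRel (T : Set ℝ) (x y : ℝ) : Prop :=
  0 < x + y ∨ x + y = 0 ∧ |x| ∈ T

variable {T S : Set ℝ} {x x' y : ℝ}

lemma ThresholdRel.symm (h : ThresholdRel T x y) : ThresholdRel T y x := by
  refine h.imp (fun h ↦ by rwa [add_comm]) fun ⟨h, hT⟩ ↦ ⟨by rwa [add_comm], ?_⟩
  rwa [eq_neg_of_add_eq_zero_right h, abs_neg]

lemma ThresholdRel.mono (hTS : T ⊆ S) (h : ThresholdRel T x y) : ThresholdRel S x y :=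
  h.imp_right fun ⟨h0, hT⟩ ↦ ⟨h0, hTS hT⟩

lemma ThresholdRel.add_nonneg (h : ThresholdRel T x y) : 0 ≤ x + y :=
  h.elim le_of_lt fun h ↦ h.1.ge

lemma ThresholdRel.mono_left (h : ThresholdRel T x y) (hx : x ≤ x') : ThresholdRel T x' y := by
  obtain rfl | hlt := hx.eq_or_lt
  · exact h
  · exact .inl (h.add_nonneg.trans_lt (by gcongr))

lemma thresholdRel_iff_of_add_ne_zero (h : x + y ≠ 0) : ThresholdRel T x y ↔ 0 < x + y := by
  simp [ThresholdRel, h]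

lemma thresholdRel_iff_of_add_eq_zero (h : x + y = 0) : ThresholdRel T x y ↔ |x| ∈ T := by
  simp [ThresholdRel, h]

variable {V : Type*}

/-- The threshold graph of the weights `a`, with the ties at the levels in `T` as edges. -/
def thresholdGraph (a : V → ℝ) (T : Set ℝ) : SimpleGraph V where
  Adj i j := i ≠ j ∧ ThresholdRel T (a i) (a j)
  symm := ⟨fun _ _ h ↦ ⟨h.1.symm, h.2.symm⟩⟩
  loopless := ⟨fun _ h ↦ h.1 rfl⟩

lemma thresholdGraph_mono (a : V → ℝ) : Monotone (thresholdGraph a) :=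
  fun _ _ hTS _ _ h ↦ ⟨h.1, h.2.mono hTS⟩

variable [Fintype V] {a : V → ℝ}

open Classical in
/-- The degree vector of a threshold graph; with `T` ranging over sets of levels, these are the
vertices of the face of the degree polytope on which the functional `a` is maximal. -/
noncomputable def thresholdVertex (a : V → ℝ) (T : Set ℝ) : V → ℝ :=
  fun i ↦ (thresholdGraph a T).degree i

open Classical in
lemma thresholdVertex_le_of_le (T : Set ℝ) {i j : V} (h : a j ≤ a i) :
    thresholdVertex a T j ≤ thresholdVertex a T i := by
  refine Nat.cast_le.mpr (Finset.card_le_card_of_injOn (Equiv.swap i j) (fun k hk ↦ ?_)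
    (Equiv.injective _).injOn)
  simp only [SimpleGraph.coe_neighborFinset, SimpleGraph.mem_neighborSet] at hk ⊢
  obtain rfl | hki := eq_or_ne k i
  · rw [Equiv.swap_apply_left]
    exact hk.symm
  · rw [Equiv.swap_apply_of_ne_of_ne hki hk.1.symm]
    exact ⟨hki.symm, hk.2.mono_left h⟩

lemma thresholdVertex_eq_of_eq (T : Set ℝ) {i j : V} (h : a i = a j) :
    thresholdVertex a T i = thresholdVertex a T j :=
  (thresholdVertex_le_of_le T h.le).antisymm (thresholdVertex_le_of_le T h.ge)

lemma antitone_thresholdVertex [Preorder V] (ha : Antitone a) (T : Set ℝ) :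
    Antitone (thresholdVertex a T) :=
  fun _ _ hij ↦ thresholdVertex_le_of_le T (ha hij)

open Classical in
lemma thresholdVertex_mono (a : V → ℝ) : Monotone (thresholdVertex a) :=
  fun _ _ hTS _ ↦ Nat.cast_le.mpr (SimpleGraph.degree_le_of_le (thresholdGraph_mono a hTS))

open Classical in
lemma thresholdVertex_congr {i : V}
    (h : ∀ j, i ≠ j → a i + a j = 0 → (|a i| ∈ T ↔ |a i| ∈ S)) :
    thresholdVertex a T i = thresholdVertex a S i := by
  suffices h : (thresholdGraph a T).neighborFinset i = (thresholdGraph a S).neighborFinset i from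
    congrArg (fun s : Finset V ↦ (s.card : ℝ)) h
  ext j
  simp only [SimpleGraph.mem_neighborFinset]
  refine and_congr_right fun hij ↦ ?_
  obtain h0 | h0 := eq_or_ne (a i + a j) 0
  · rw [thresholdRel_iff_of_add_eq_zero h0, thresholdRel_iff_of_add_eq_zero h0, h j hij h0]
  · rw [thresholdRel_iff_of_add_ne_zero h0, thresholdRel_iff_of_add_ne_zero h0]

open Classical in
lemma thresholdVertex_lt_of_tie (hTS : T ⊆ S) {i j : V} (hij : i ≠ j) (h0 : a i + a j = 0)
    (hT : |a i| ∉ T) (hS : |a i| ∈ S) : thresholdVertex a T i < thresholdVertex a S i := by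
  refine Nat.cast_lt.mpr (Finset.card_lt_card
    ⟨Set.toFinset_mono (SimpleGraph.neighborSet_mono (thresholdGraph_mono a hTS) i),
      fun hle ↦ ?_⟩)
  have hj := hle ((SimpleGraph.mem_neighborFinset _ _ _).mpr ⟨hij, .inr ⟨h0, hS⟩⟩)
  rw [SimpleGraph.mem_neighborFinset] at hj
  exact hT ((thresholdRel_iff_of_add_eq_zero h0).mp hj.2)

end ThresholdGraph

section FractionalGraph

open Matrix

variable {V : Type*} {a : V → ℝ} {w : V → V → ℝ}

/-- The edge weights of a fractional simple graph. -/
structure IsFractionalGraph (w : V → V → ℝ) : Prop where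
  symm : ∀ i j, w i j = w j i
  loopless : ∀ i, w i i = 0
  mem_Icc : ∀ i j, w i j ∈ Set.Icc 0 1

lemma convex_isFractionalGraph : Convex ℝ {w : V → V → ℝ | IsFractionalGraph w} := by
  intro w hw v hv s t hs ht hst
  refine ⟨fun i j ↦ ?_, fun i ↦ ?_,
    fun i j ↦ convex_Icc (0 : ℝ) 1 (hw.mem_Icc i j) (hv.mem_Icc i j) hs ht hst⟩
  · simp [hw.symm i, hv.symm i]
  · simp [hw.loopless, hv.loopless]

open Classical in
lemma isFractionalGraph_ite_adj (G : SimpleGraph V) :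
    IsFractionalGraph fun i j ↦ if G.Adj i j then (1 : ℝ) else 0 :=
  ⟨fun i j ↦ by simp only [G.adj_comm], fun i ↦ by simp, fun i j ↦ by split_ifs <;> simp⟩

open Classical in
lemma IsFractionalGraph.mul_sub_nonneg (hw : IsFractionalGraph w) (T : Set ℝ) (i j : V) :
    0 ≤ (a i + a j) * ((if (thresholdGraph a T).Adj i j then 1 else 0) - w i j) := by
  split_ifs with h
  · exact mul_nonneg h.2.add_nonneg (sub_nonneg.mpr (hw.mem_Icc i j).2)
  · obtain rfl | hij := eq_or_ne i j
    · simp [hw.loopless]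
    · refine mul_nonneg_of_nonpos_of_nonpos (not_lt.mp fun h0 ↦ h ⟨hij, .inl h0⟩) ?_
      simpa using (hw.mem_Icc i j).1

variable [Fintype V] {x : V → ℝ} {T : Set ℝ}

/-- The degree vectors of fractional simple graphs: a convex set that contains all degree vectors
and on which each linear functional `a` is maximal at the degree vector of a threshold graph. -/
def fractionalDegrees (V : Type*) [Fintype V] : Set (V → ℝ) :=
  (fun w i ↦ ∑ j, w i j) '' {w : V → V → ℝ | IsFractionalGraph w}

lemma convex_fractionalDegrees : Convex ℝ (fractionalDegrees V) := by
  refine convex_isFractionalGraph.is_linear_image ⟨fun w v ↦ ?_, fun c w ↦ ?_⟩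
  · ext i
    simp [Finset.sum_add_distrib]
  · ext i
    simp [Finset.mul_sum]

open Classical in
lemma degree_mem_fractionalDegrees (G : SimpleGraph V) :
    (fun i ↦ (G.degree i : ℝ)) ∈ fractionalDegrees V :=
  ⟨_, isFractionalGraph_ite_adj G, funext fun i ↦ (G.degree_eq_sum_if_adj i).symm⟩

lemma thresholdVertex_mem_fractionalDegrees (a : V → ℝ) (T : Set ℝ) :
    thresholdVertex a T ∈ fractionalDegrees V :=
  degree_mem_fractionalDegrees _

lemma comp_perm_mem_fractionalDegrees (hx : x ∈ fractionalDegrees V) (σ : Equiv.Perm V) :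
    x ∘ σ ∈ fractionalDegrees V := by
  obtain ⟨w, hw, rfl⟩ := hx
  exact ⟨fun i j ↦ w (σ i) (σ j), ⟨fun i j ↦ hw.symm _ _, fun i ↦ hw.loopless _,
    fun i j ↦ hw.mem_Icc _ _⟩, funext fun i ↦ Equiv.sum_comp σ (w (σ i))⟩

lemma two_mul_dotProduct_rowSum (hw : ∀ i j, w i j = w j i) :
    2 * a ⬝ᵥ (fun i ↦ ∑ j, w i j) = ∑ i, ∑ j, (a i + a j) * w i j := by
  have hrow : a ⬝ᵥ (fun i ↦ ∑ j, w i j) = ∑ i, ∑ j, a i * w i j := by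
    simp only [dotProduct, Finset.mul_sum]
  have hcol : a ⬝ᵥ (fun i ↦ ∑ j, w i j) = ∑ i, ∑ j, a j * w i j := by
    rw [hrow, Finset.sum_comm]
    simp only [hw]
  simp only [add_mul, Finset.sum_add_distrib, ← hrow, ← hcol, two_mul]

open Classical in
lemma IsFractionalGraph.two_mul_dotProduct_sub (hw : IsFractionalGraph w) (T : Set ℝ) :
    2 * (a ⬝ᵥ thresholdVertex a T - a ⬝ᵥ fun i ↦ ∑ j, w i j) =
      ∑ i, ∑ j, (a i + a j) * ((if (thresholdGraph a T).Adj i j then 1 else 0) - w i j) := by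
  have hd : thresholdVertex a T =
      fun i ↦ ∑ j, if (thresholdGraph a T).Adj i j then (1 : ℝ) else 0 :=
    funext fun i ↦ SimpleGraph.degree_eq_sum_if_adj _ i
  rw [mul_sub, two_mul_dotProduct_rowSum hw.symm, hd,
    two_mul_dotProduct_rowSum (isFractionalGraph_ite_adj _).symm]
  simp only [mul_sub, Finset.sum_sub_distrib]

lemma dotProduct_le_thresholdVertex (T : Set ℝ) (hx : x ∈ fractionalDegrees V) :
    a ⬝ᵥ x ≤ a ⬝ᵥ thresholdVertex a T := by
  obtain ⟨w, hw, rfl⟩ := hx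
  have h : 0 ≤ 2 * (a ⬝ᵥ thresholdVertex a T - a ⬝ᵥ fun i ↦ ∑ j, w i j) := by
    rw [hw.two_mul_dotProduct_sub T]
    exact Finset.sum_nonneg fun i _ ↦ Finset.sum_nonneg fun j _ ↦ hw.mul_sub_nonneg T i j
  linarith

lemma dotProduct_thresholdVertex_eq (a : V → ℝ) (T S : Set ℝ) :
    a ⬝ᵥ thresholdVertex a T = a ⬝ᵥ thresholdVertex a S :=
  (dotProduct_le_thresholdVertex S (thresholdVertex_mem_fractionalDegrees a T)).antisymm
    (dotProduct_le_thresholdVertex T (thresholdVertex_mem_fractionalDegrees a S))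

open Classical in
lemma IsFractionalGraph.eq_ite_of_dotProduct_eq (hw : IsFractionalGraph w)
    (h : a ⬝ᵥ (fun i ↦ ∑ j, w i j) = a ⬝ᵥ thresholdVertex a T) {i j : V} (h0 : a i + a j ≠ 0) :
    w i j = if (thresholdGraph a T).Adj i j then 1 else 0 := by
  have hsum := (hw.two_mul_dotProduct_sub (a := a) T).symm
  rw [h, sub_self, mul_zero, Finset.sum_eq_zero_iff_of_nonneg fun i _ ↦
    Finset.sum_nonneg fun j _ ↦ hw.mul_sub_nonneg T i j] at hsum
  have hrow := hsum i (Finset.mem_univ i)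
  rw [Finset.sum_eq_zero_iff_of_nonneg fun j _ ↦ hw.mul_sub_nonneg T i j] at hrow
  exact (sub_eq_zero.mp ((mul_eq_zero.mp (hrow j (Finset.mem_univ j))).resolve_left h0)).symm

open Classical in
lemma mem_Icc_of_dotProduct_eq (hx : x ∈ fractionalDegrees V)
    (h : a ⬝ᵥ x = a ⬝ᵥ thresholdVertex a ∅) :
    x ∈ Set.Icc (thresholdVertex a ∅) (thresholdVertex a Set.univ) := by
  obtain ⟨w, hw, rfl⟩ := hx
  constructor <;> intro i <;> simp only [thresholdVertex, SimpleGraph.degree_eq_sum_if_adj] <;>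
    refine Finset.sum_le_sum fun j _ ↦ ?_
  · split_ifs with hadj
    · have hpos : 0 < a i + a j := hadj.2.resolve_right fun h ↦ h.2
      rw [hw.eq_ite_of_dotProduct_eq h hpos.ne', if_pos hadj]
    · exact (hw.mem_Icc i j).1
  · split_ifs with hadj
    · exact (hw.mem_Icc i j).2
    · obtain rfl | hij := eq_or_ne i j
      · exact (hw.loopless i).le
      · have h0 : a i + a j ≠ 0 := fun h0 ↦ hadj ⟨hij, .inr ⟨h0, trivial⟩⟩
        rw [hw.eq_ite_of_dotProduct_eq h h0,
          if_neg fun h ↦ hadj (thresholdGraph_mono a (Set.empty_subset _) h)]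

end FractionalGraph

section Projection

open Matrix Filter Topology

variable {ι : Type*}

lemma convex_setOf_antitone [Preorder ι] : Convex ℝ {x : ι → ℝ | Antitone x} :=
  fun _ hx _ hy _ _ hs ht _ ↦ (hx.const_smul hs).add (hy.const_smul ht)

lemma eventually_antitone_add_smul [Finite ι] [Preorder ι] {a x : ι → ℝ} (ha : Antitone a)
    (hx : ∀ i j, a i = a j → x i = x j) :
    ∀ᶠ ε : ℝ in 𝓝 0, Antitone (a + ε • x) := by
  simp only [Antitone, eventually_all]
  intro i j hij
  obtain heq | hlt := (ha hij).eq_or_lt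
  · exact .of_forall fun ε ↦ by simp [heq, hx _ _ heq]
  · have hcont (k : ι) : Tendsto (fun ε : ℝ ↦ (a + ε • x) k) (𝓝 0) (𝓝 (a k)) :=
      Continuous.tendsto' (by simp only [Pi.add_apply, Pi.smul_apply]; fun_prop) _ _ (by simp)
    exact ((hcont j).eventually_lt (hcont i) hlt).mono fun _ ↦ le_of_lt

variable [Fintype ι]

lemma exists_forall_dotProduct_sub_nonneg {K : Set (ι → ℝ)} (hne : K.Nonempty)
    (hcl : IsClosed K) (hK : Convex ℝ K) (c : ι → ℝ) :
    ∃ a ∈ K, ∀ x ∈ K, 0 ≤ (a - c) ⬝ᵥ (x - a) := by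
  let e := WithLp.linearEquiv 2 ℝ (ι → ℝ)
  have hconv : Convex ℝ (e ⁻¹' K) := hK.linear_preimage e.toLinearMap
  have hcompl : IsComplete (e ⁻¹' K) := (hcl.preimage (PiLp.continuous_ofLp 2 _)).isComplete
  obtain ⟨a, ha, hmin⟩ := exists_norm_eq_iInf_of_complete_convex
    (hne.preimage e.surjective) hcompl hconv (e.symm c)
  refine ⟨e a, ha, fun x hx ↦ ?_⟩
  have hinner := (norm_eq_iInf_iff_real_inner_le_zero hconv ha).mp hmin (e.symm x) (by simpa)
  rw [EuclideanSpace.inner_eq_star_dotProduct, star_trivial, dotProduct_comm] at hinner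
  rw [← neg_sub, neg_dotProduct]
  exact neg_nonneg.mpr hinner

variable [Preorder ι]

lemma exists_antitone_dotProduct_ge (c : ι → ℝ) :
    ∃ a : ι → ℝ, Antitone a ∧ (∀ x, Antitone x → c ⬝ᵥ x ≤ a ⬝ᵥ x) ∧
      ∀ x, (∀ i j, a i = a j → x i = x j) → c ⬝ᵥ x = a ⬝ᵥ x := by
  -- `a` is the point closest to `c` in the cone of antitone vectors.
  have hcl : IsClosed {x : ι → ℝ | Antitone x} := by
    simp only [Antitone, Set.ofPred_forall]
    exact isClosed_iInter fun i ↦ isClosed_iInter fun j ↦ isClosed_iInter fun _ ↦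
      isClosed_le (continuous_apply j) (continuous_apply i)
  obtain ⟨a, ha, hmin⟩ := exists_forall_dotProduct_sub_nonneg ⟨0, antitone_const⟩ hcl
    convex_setOf_antitone c
  refine ⟨a, ha, fun x hx ↦ ?_, fun x hx ↦ ?_⟩
  · have h := hmin (a + x) (ha.add hx)
    rwa [add_sub_cancel_left, sub_dotProduct, sub_nonneg] at h
  · have hloc : IsLocalMin (fun ε : ℝ ↦ ε * ((a - c) ⬝ᵥ x)) 0 :=
      (eventually_antitone_add_smul ha hx).mono fun ε hε ↦ by
        simpa [dotProduct_smul] using hmin _ hε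
    have h := hloc.hasDerivAt_eq_zero ((hasDerivAt_id 0).mul_const _)
    rw [one_mul, sub_dotProduct, sub_eq_zero] at h
    exact h.symm

end Projection

section ExposedFaces

variable {E : Type*} [AddCommGroup E] [Module ℝ E]

lemma isExposed_setOf_forall_eq [TopologicalSpace E] [IsTopologicalAddGroup E]
    [ContinuousConstSMul ℝ E] {ι : Type*} [Finite ι] {P : Set E} (f : ι → StrongDual ℝ E)
    (M : ι → ℝ) (h : ∀ i, ∀ x ∈ P, f i x ≤ M i) :
    IsExposed ℝ P {x ∈ P | ∀ i, f i x = M i} := by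
  have := Fintype.ofFinite ι
  rintro ⟨z, hz, hzM⟩
  refine ⟨∑ i, f i, Set.ext fun x ↦ and_congr_right fun hx ↦ ?_⟩
  have hle (y) (hy : y ∈ P) : (∑ i, f i) y ≤ ∑ i, M i := by
    rw [sum_apply]
    exact Finset.sum_le_sum fun i _ ↦ h i y hy
  have hz : (∑ i, f i) z = ∑ i, M i := by simp [hzM]
  calc
    (∀ i, f i x = M i) ↔ (∑ i, f i) x = ∑ i, M i := by
      rw [sum_apply, Finset.sum_eq_sum_iff_of_le fun i _ ↦ h i x hx]
      simp
    _ ↔ ∀ y ∈ P, (∑ i, f i) y ≤ (∑ i, f i) x :=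
      ⟨fun hx' y hy ↦ (hle y hy).trans_eq hx'.symm,
        fun hmax ↦ (hle x hx).antisymm (hz ▸ hmax z ‹z ∈ P›)⟩

lemma finrank_vectorSpan_segment {x y : E} (h : x ≠ y) :
    Module.finrank ℝ (vectorSpan ℝ (segment ℝ x y)) = 1 := by
  rw [← convexHull_pair, ← direction_affineSpan, affineSpan_convexHull, direction_affineSpan,
    vectorSpan_pair, finrank_span_singleton (vsub_ne_zero.mpr h)]

variable [PartialOrder E] [IsOrderedAddMonoid E] [PosSMulMono ℝ E] {x y z : E}

lemma segment_injOn_le :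
    Set.InjOn (fun e : E × E ↦ segment ℝ e.1 e.2) {e | e.1 ≤ e.2} := by
  rintro ⟨x, y⟩ hxy ⟨z, w⟩ hzw h
  dsimp only at h
  have hx := segment_subset_Icc hzw (h ▸ left_mem_segment ℝ x y)
  have hy := segment_subset_Icc hzw (h ▸ right_mem_segment ℝ x y)
  have hz := segment_subset_Icc hxy (h.symm ▸ left_mem_segment ℝ z w)
  have hw := segment_subset_Icc hxy (h.symm ▸ right_mem_segment ℝ z w)
  exact Prod.ext (hz.1.antisymm hx.1) (hy.2.antisymm hw.2)

lemma mem_segment_of_collinear (h : Collinear ℝ {x, y, z}) (hy : y ∈ Set.Icc x z) :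
    y ∈ segment ℝ x z := by
  obtain h | h | h := h.wbtw_or_wbtw_or_wbtw
  · exact h.mem_segment
  · have hzy := (segment_subset_Icc hy.1 (segment_symm ℝ y x ▸ h.mem_segment)).2
    exact hy.2.antisymm hzy ▸ right_mem_segment ℝ x y
  · have hyx := (segment_subset_Icc hy.2 (segment_symm ℝ z y ▸ h.mem_segment)).1
    exact hyx.antisymm hy.1 ▸ left_mem_segment ℝ y z

end ExposedFaces

section Edges

open Matrix

variable {n : ℕ} {a x : Fin n → ℝ}

open Classical in
/-- The set of levels `|x|` at which the weights in the multiset `M` have a tie, that is, contain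
both `x` and `-x`, at different positions. -/
def tieLevels (M : Multiset ℝ) : Set ℝ :=
  {t | ∃ x ∈ M, -x ∈ M.erase x ∧ |x| = t}

lemma mem_tieLevels_map {V : Type*} [Fintype V] {a : V → ℝ} {t : ℝ} :
    t ∈ tieLevels (Finset.univ.val.map a) ↔ ∃ i j, i ≠ j ∧ a i + a j = 0 ∧ |a i| = t := by
  classical
  have herase (i : V) :
      -a i ∈ (Finset.univ.val.map a).erase (a i) ↔ ∃ j, i ≠ j ∧ a i + a j = 0 := by
    rw [← Multiset.map_erase_of_mem a _ (Finset.mem_univ_val i), Multiset.mem_map]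
    simp only [Multiset.Nodup.mem_erase_iff Finset.univ.nodup, ne_comm (a := i),
      add_eq_zero_iff_neg_eq, eq_comm (a := -a i), Finset.mem_univ_val, and_true]
  constructor
  · rintro ⟨x, hx, hneg, rfl⟩
    obtain ⟨i, -, rfl⟩ := Multiset.mem_map.mp hx
    obtain ⟨j, hij, h0⟩ := (herase i).mp hneg
    exact ⟨i, j, hij, h0, rfl⟩
  · rintro ⟨i, j, hij, h0, rfl⟩
    exact ⟨a i, Multiset.mem_map_of_mem a (Finset.mem_univ_val i), (herase i).mpr ⟨j, hij, h0⟩, rfl⟩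

lemma thresholdVertex_congr_of_notMem {V : Type*} [Fintype V] {a : V → ℝ} {i : V}
    (h : |a i| ∉ tieLevels (Finset.univ.val.map a)) (T S : Set ℝ) :
    thresholdVertex a T i = thresholdVertex a S i :=
  thresholdVertex_congr fun j hij h0 ↦ (h (mem_tieLevels_map.mpr ⟨i, j, hij, h0, rfl⟩)).elim

lemma antitone_of_mem_degreePartitionPolytope (hx : x ∈ degreePartitionPolytope n) :
    Antitone x := by
  refine convexHull_min ?_ convex_setOf_antitone hx
  rintro _ ⟨d, ⟨G, hd, -⟩, rfl⟩
  exact Nat.mono_cast.comp_antitone hd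

lemma degreePartitionPolytope_subset_fractionalDegrees :
    degreePartitionPolytope n ⊆ fractionalDegrees (Fin n) := by
  refine convexHull_min ?_ convex_fractionalDegrees
  rintro _ ⟨d, ⟨G, -, σ, rfl⟩, rfl⟩
  exact comp_perm_mem_fractionalDegrees (degree_mem_fractionalDegrees G) σ

lemma thresholdVertex_mem_degreePartitionPolytope (ha : Antitone a) (T : Set ℝ) :
    thresholdVertex a T ∈ degreePartitionPolytope n :=
  subset_convexHull ℝ _ ⟨degreeSequence (thresholdGraph a T), ⟨_, fun _ _ hij ↦
    Nat.cast_le.mp (antitone_thresholdVertex ha T hij), 1, rfl⟩, rfl⟩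

lemma exists_thresholdVertex_mem_of_isExposed {F : Set (Fin n → ℝ)}
    (hF : IsExposed ℝ (degreePartitionPolytope n) F) (hne : F.Nonempty) :
    ∃ a : Fin n → ℝ, Antitone a ∧ (∀ T, thresholdVertex a T ∈ F) ∧
      F ⊆ Set.Icc (thresholdVertex a ∅) (thresholdVertex a Set.univ) := by
  obtain ⟨l, hl⟩ := hF hne
  obtain ⟨c, hc⟩ : ∃ c : Fin n → ℝ, ∀ x, l x = c ⬝ᵥ x :=
    ⟨fun i ↦ l fun j ↦ if i = j then 1 else 0, fun x ↦ by
      simpa [dotProduct, mul_comm] using LinearMap.pi_apply_eq_sum_univ (l : (Fin n → ℝ) →ₗ[ℝ] ℝ) x⟩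
  simp only [hc] at hl
  obtain ⟨a, ha, hge, heq⟩ := exists_antitone_dotProduct_ge c
  have hvertex (T : Set ℝ) : c ⬝ᵥ thresholdVertex a T = a ⬝ᵥ thresholdVertex a T :=
    heq _ fun i j ↦ thresholdVertex_eq_of_eq T
  have hle (T : Set ℝ) {x} (hx : x ∈ degreePartitionPolytope n) :
      a ⬝ᵥ x ≤ c ⬝ᵥ thresholdVertex a T :=
    hvertex T ▸
      dotProduct_le_thresholdVertex T (degreePartitionPolytope_subset_fractionalDegrees hx)
  have hca {x} (hx : x ∈ degreePartitionPolytope n) : c ⬝ᵥ x ≤ a ⬝ᵥ x :=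
    hge x (antitone_of_mem_degreePartitionPolytope hx)
  refine ⟨a, ha, fun T ↦ ?_, fun x hx ↦ ?_⟩
  · rw [hl]
    exact ⟨thresholdVertex_mem_degreePartitionPolytope ha T, fun y hy ↦ (hca hy).trans (hle T hy)⟩
  · rw [hl] at hx
    refine mem_Icc_of_dotProduct_eq (degreePartitionPolytope_subset_fractionalDegrees hx.1) ?_
    rw [← hvertex]
    exact (hle ∅ hx.1).antisymm
      ((hx.2 _ (thresholdVertex_mem_degreePartitionPolytope ha ∅)).trans (hca hx.1))

lemma eq_of_mem_tieLevels_of_mem_segment {s t : ℝ}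
    (hmem : thresholdVertex a {t} ∈ segment ℝ (thresholdVertex a ∅) (thresholdVertex a Set.univ))
    (hs : s ∈ tieLevels (Finset.univ.val.map a)) (ht : t ∈ tieLevels (Finset.univ.val.map a)) :
    s = t := by
  obtain ⟨i, j, hij, h0, rfl⟩ := mem_tieLevels_map.mp ht
  obtain ⟨k, l, hkl, h0', rfl⟩ := mem_tieLevels_map.mp hs
  by_contra hne
  rw [segment_eq_image_lineMap] at hmem
  obtain ⟨θ, -, hθ⟩ := hmem
  have hlt_i := thresholdVertex_lt_of_tie (Set.empty_subset Set.univ) hij h0 id trivial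
  have hlt_k := thresholdVertex_lt_of_tie (Set.empty_subset Set.univ) hkl h0' id trivial
  have hi : thresholdVertex a {|a i|} i = thresholdVertex a Set.univ i :=
    thresholdVertex_congr fun _ _ _ ↦ by simp
  have hk : thresholdVertex a {|a i|} k = thresholdVertex a ∅ k :=
    thresholdVertex_congr fun _ _ _ ↦ by simp [hne]
  have hθi := congrFun hθ i
  have hθk := congrFun hθ k
  rw [hi, AffineMap.pi_lineMap_apply, AffineMap.lineMap_eq_right_iff] at hθi
  rw [hk, AffineMap.pi_lineMap_apply, AffineMap.lineMap_eq_left_iff] at hθk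
  exact one_ne_zero ((hθi.resolve_left hlt_i.ne).symm.trans (hθk.resolve_left hlt_k.ne))

lemma exists_eq_segment_of_mem_polytopeEdges {F : Set (Fin n → ℝ)}
    (hF : F ∈ polytopeEdges (degreePartitionPolytope n)) :
    ∃ a : Fin n → ℝ, Antitone a ∧ tieLevels (Finset.univ.val.map a) ∈ Set.range singleton ∧
      segment ℝ (thresholdVertex a ∅) (thresholdVertex a Set.univ) = F := by
  obtain ⟨hexp, hrank⟩ := hF
  have hnontriv : F.Nontrivial := by
    rw [← Set.not_subsingleton_iff]
    intro hsub
    rw [vectorSpan_of_subsingleton ℝ hsub, finrank_bot] at hrank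
    exact zero_ne_one hrank
  obtain ⟨a, ha, hmem, hIcc⟩ := exists_thresholdVertex_mem_of_isExposed hexp hnontriv.nonempty
  have hseg : segment ℝ (thresholdVertex a ∅) (thresholdVertex a Set.univ) = F := by
    refine (hexp.convex (convex_convexHull ℝ _)).segment_subset (hmem _) (hmem _) |>.antisymm
      fun x hx ↦ mem_segment_of_collinear ?_ (hIcc hx)
    exact (collinear_iff_finrank_le_one.mpr hrank.le).subset <|
      Set.insert_subset (hmem _) (Set.insert_subset hx (Set.singleton_subset_iff.mpr (hmem _)))
  refine ⟨a, ha, ?_, hseg⟩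
  obtain hempty | ⟨t, ht⟩ := (tieLevels (Finset.univ.val.map a)).eq_empty_or_nonempty
  · have hendpoints : thresholdVertex a ∅ = thresholdVertex a Set.univ :=
      funext fun i ↦ thresholdVertex_congr_of_notMem (hempty ▸ Set.notMem_empty _) _ _
    rw [← hseg, hendpoints, segment_same] at hnontriv
    exact (Set.not_nontrivial_singleton hnontriv).elim
  · exact ⟨t, (Set.eq_singleton_iff_unique_mem.mpr ⟨ht, fun s hs ↦
      eq_of_mem_tieLevels_of_mem_segment (hseg ▸ hmem {t}) hs ht⟩).symm⟩

lemma eq_zero_of_dotProduct_eq_zero {V : Type*} [Fintype V] {a z : V → ℝ} {i : V}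
    (hblock : ∀ j k, a j = a k → z j = z k) (hsupp : ∀ k, |a k| ≠ |a i| → z k = 0)
    (h0 : a ⬝ᵥ z = 0) (hi : z i = 0) : z = 0 := by
  have hne {k} (hk : z k ≠ 0) : a k = -a i :=
    (abs_eq_abs.mp (not_imp_comm.mp (hsupp k) hk)).resolve_left fun h ↦ hk (hblock k i h ▸ hi)
  funext k
  by_contra hk
  have hnonneg (j) (_ : j ∈ Finset.univ) : 0 ≤ a j * z j * (a k * z k) := by
    obtain hj | hj := eq_or_ne (z j) 0
    · simp [hj]
    · have hjk : a j = a k := (hne hj).trans (hne hk).symm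
      rw [hjk, hblock j k hjk]
      exact mul_self_nonneg _
  have hsum : ∑ j, a j * z j * (a k * z k) = 0 := by
    rw [← Finset.sum_mul, ← dotProduct, h0, zero_mul]
  have hzero := (Finset.sum_eq_zero_iff_of_nonneg hnonneg).mp hsum k (Finset.mem_univ k)
  have hak : a k = 0 := (mul_eq_zero.mp (mul_self_eq_zero.mp hzero)).resolve_right hk
  have hai : a i = 0 := neg_eq_zero.mp (hne hk ▸ hak)
  exact hk (hblock k i (hak.trans hai.symm) ▸ hi)

/-- The face of the polytope on which the functional `a` is maximal and the coordinates are
constant on the level sets of `a`. -/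
def thresholdFace (a : Fin n → ℝ) : Set (Fin n → ℝ) :=
  {x ∈ degreePartitionPolytope n | a ⬝ᵥ x = a ⬝ᵥ thresholdVertex a ∅ ∧
    ∀ i j, a i = a j → x i = x j}

lemma isExposed_thresholdFace (a : Fin n → ℝ) :
    IsExposed ℝ (degreePartitionPolytope n) (thresholdFace a) := by
  let tied := {p : Fin n × Fin n // p.1 ≤ p.2 ∧ a p.1 = a p.2}
  have hmax := isExposed_setOf_forall_eq (P := degreePartitionPolytope n)
    (fun _ : Unit ↦ (dotProductBilin ℝ ℝ a).toContinuousLinearMap)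
    (fun _ ↦ a ⬝ᵥ thresholdVertex a ∅) fun _ x hx ↦
      dotProduct_le_thresholdVertex ∅ (degreePartitionPolytope_subset_fractionalDegrees hx)
  have hblock := isExposed_setOf_forall_eq (P := degreePartitionPolytope n)
    (fun p : tied ↦ ContinuousLinearMap.proj (R := ℝ) (φ := fun _ : Fin n ↦ ℝ) p.1.2 -
      ContinuousLinearMap.proj p.1.1)
    (fun _ ↦ 0) fun p x hx ↦
      sub_nonpos.mpr (antitone_of_mem_degreePartitionPolytope hx p.2.1)
  refine (congrArg (IsExposed ℝ _) (Set.ext fun x ↦ ?_)).mpr (hmax.inter hblock)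
  refine ⟨fun ⟨hx, hax, hconst⟩ ↦
    ⟨⟨hx, fun _ ↦ hax⟩, hx, fun p ↦ sub_eq_zero.mpr (hconst _ _ p.2.2.symm)⟩,
    fun ⟨⟨hx, hax⟩, _, hconst⟩ ↦ ⟨hx, hax (), fun i j hij ↦ ?_⟩⟩
  obtain hle | hle := le_total i j
  · exact (sub_eq_zero.mp (hconst ⟨(i, j), hle, hij⟩)).symm
  · exact sub_eq_zero.mp (hconst ⟨(j, i), hle, hij.symm⟩)

lemma thresholdVertex_mem_thresholdFace (ha : Antitone a) (T : Set ℝ) :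
    thresholdVertex a T ∈ thresholdFace a :=
  ⟨thresholdVertex_mem_degreePartitionPolytope ha T, dotProduct_thresholdVertex_eq a T ∅,
    fun _ _ ↦ thresholdVertex_eq_of_eq T⟩

lemma thresholdFace_subset_segment {i : Fin n}
    (hties : tieLevels (Finset.univ.val.map a) = {|a i|})
    (hi : thresholdVertex a ∅ i < thresholdVertex a Set.univ i) :
    thresholdFace a ⊆ segment ℝ (thresholdVertex a ∅) (thresholdVertex a Set.univ) := by
  rintro x ⟨hxP, hax, hconst⟩
  have hIcc := mem_Icc_of_dotProduct_eq (degreePartitionPolytope_subset_fractionalDegrees hxP) hax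
  set u := thresholdVertex a ∅
  set v := thresholdVertex a Set.univ
  have huv : a ⬝ᵥ v = a ⬝ᵥ u := dotProduct_thresholdVertex_eq a _ _
  let θ := (x i - u i) / (v i - u i)
  have hpos : 0 < v i - u i := sub_pos.mpr hi
  suffices hz : x - u - θ • (v - u) = 0 by
    rw [segment_eq_image_lineMap]
    refine ⟨θ, ⟨div_nonneg (sub_nonneg.mpr (hIcc.1 i)) hpos.le,
      (div_le_one hpos).mpr (sub_le_sub_right (hIcc.2 i) _)⟩, ?_⟩
    rw [AffineMap.lineMap_apply_module', ← sub_eq_zero.mp hz, sub_add_cancel]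
  refine eq_zero_of_dotProduct_eq_zero (a := a) (i := i) (fun j k hjk ↦ ?_) (fun k hk ↦ ?_) ?_ ?_
  · simp only [Pi.sub_apply, Pi.smul_apply, hconst j k hjk, u, v, thresholdVertex_eq_of_eq _ hjk]
  · have huvk : u k = v k := thresholdVertex_congr_of_notMem (by rwa [hties]) _ _
    have hxk : x k = u k := (huvk ▸ hIcc.2 k).antisymm (hIcc.1 k)
    simp [hxk, huvk]
  · simp [dotProduct_sub, dotProduct_smul, hax, huv]
  · simp [θ, div_mul_cancel₀ _ hpos.ne']

lemma segment_mem_polytopeEdges (ha : Antitone a)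
    (hties : tieLevels (Finset.univ.val.map a) ∈ Set.range singleton) :
    segment ℝ (thresholdVertex a ∅) (thresholdVertex a Set.univ) ∈
      polytopeEdges (degreePartitionPolytope n) := by
  obtain ⟨t, ht⟩ := hties
  obtain ⟨i, j, hij, h0, rfl⟩ := mem_tieLevels_map.mp (ht ▸ Set.mem_singleton t)
  have hlt := thresholdVertex_lt_of_tie (Set.empty_subset Set.univ) hij h0 id trivial
  have hface : segment ℝ (thresholdVertex a ∅) (thresholdVertex a Set.univ) = thresholdFace a :=
    (((isExposed_thresholdFace a).convex (convex_convexHull ℝ _)).segment_subset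
      (thresholdVertex_mem_thresholdFace ha _) (thresholdVertex_mem_thresholdFace ha _)).antisymm
      (thresholdFace_subset_segment ht.symm hlt)
  exact ⟨hface ▸ isExposed_thresholdFace a, finrank_vectorSpan_segment fun h ↦
    hlt.ne (congrFun h i)⟩

theorem polytopeEdges_degreePartitionPolytope (n : ℕ) :
    polytopeEdges (degreePartitionPolytope n) =
      (fun a ↦ segment ℝ (thresholdVertex a ∅) (thresholdVertex a Set.univ)) ''
        {a : Fin n → ℝ | Antitone a ∧
          tieLevels (Finset.univ.val.map a) ∈ Set.range singleton} := by
  ext F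
  constructor
  · intro hF
    obtain ⟨a, ha, hties, hseg⟩ := exists_eq_segment_of_mem_polytopeEdges hF
    exact ⟨a, ⟨ha, hties⟩, hseg⟩
  · rintro ⟨a, ⟨ha, hties⟩, rfl⟩
    exact segment_mem_polytopeEdges ha hties

end Edges

section RelDegrees

open Multiset

variable {α : Type*} [DecidableEq α] {r : α → α → Prop} [DecidableRel r] {M : Multiset α} {x : α}

/-- The multiset of degrees of the graph whose vertices are the elements of `M`, counted with
multiplicity, with `x` and `y` at different positions adjacent when `r x y`. -/
def relDegrees (r : α → α → Prop) [DecidableRel r] (M : Multiset α) : Multiset ℕ :=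
  M.map fun x ↦ (M.erase x).countP (r x)

/-- The effect on the multiset of degrees of adding a vertex adjacent to all others. -/
def dominate (X : Multiset ℕ) : Multiset ℕ :=
  card X ::ₘ X.map (· + 1)

/-- The effect on the multiset of degrees of adding an isolated vertex. -/
def isolate (X : Multiset ℕ) : Multiset ℕ :=
  0 ::ₘ X

lemma card_dominate (X : Multiset ℕ) : card (dominate X) = card X + 1 := by
  simp [dominate]

lemma dominate_injective : Function.Injective dominate := by
  intro X Y h
  have hcard : card X = card Y := by simpa [dominate] using congrArg card h
  rw [dominate, dominate, hcard, cons_inj_right] at h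
  exact map_injective (add_left_injective 1) h

lemma isolate_injective : Function.Injective isolate := fun _ _ h ↦ (cons_inj_right 0).mp h

lemma card_relDegrees (r : α → α → Prop) [DecidableRel r] (M : Multiset α) :
    card (relDegrees r M) = card M :=
  card_map _ _

lemma relDegrees_cons (hr : ∀ x y, r x y → r y x) (x : α) (M : Multiset α) :
    relDegrees r (x ::ₘ M) =
      M.countP (r x) ::ₘ M.map fun y ↦ (M.erase y).countP (r y) + if r x y then 1 else 0 := by
  rw [relDegrees, map_cons, erase_cons_head]
  refine congrArg _ (map_congr rfl fun y hy ↦ ?_)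
  rw [erase_cons_tail_of_mem hy, countP_cons]
  simp only [show r y x ↔ r x y from ⟨hr y x, hr x y⟩]

lemma relDegrees_cons_of_forall (hr : ∀ x y, r x y → r y x) (h : ∀ y ∈ M, r x y) :
    relDegrees r (x ::ₘ M) = dominate (relDegrees r M) := by
  rw [relDegrees_cons hr, dominate, card_relDegrees, relDegrees, map_map, countP_eq_card.mpr h]
  exact congrArg _ (map_congr rfl fun y hy ↦ by simp [h y hy])

lemma relDegrees_cons_of_forall_not (hr : ∀ x y, r x y → r y x) (h : ∀ y ∈ M, ¬r x y) :
    relDegrees r (x ::ₘ M) = isolate (relDegrees r M) := by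
  rw [relDegrees_cons hr, isolate, relDegrees, countP_eq_zero.mpr h]
  exact congrArg _ (map_congr rfl fun y hy ↦ by simp [h y hy])

lemma relDegrees_replicate_add_of_forall (hr : ∀ x y, r x y → r y x) (hx : r x x)
    (h : ∀ y ∈ M, r x y) (p : ℕ) :
    relDegrees r (replicate p x + M) = dominate^[p] (relDegrees r M) := by
  induction p with
  | zero => simp
  | succ p ih =>
    rw [replicate_succ, cons_add, Function.iterate_succ_apply', ← ih]
    refine relDegrees_cons_of_forall hr fun y hy ↦ (mem_add.mp hy).elim (fun hy ↦ ?_) (h y)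
    rwa [eq_of_mem_replicate hy]

lemma relDegrees_replicate_add_of_forall_not (hr : ∀ x y, r x y → r y x) (hx : ¬r x x)
    (h : ∀ y ∈ M, ¬r x y) (q : ℕ) :
    relDegrees r (replicate q x + M) = isolate^[q] (relDegrees r M) := by
  induction q with
  | zero => simp
  | succ q ih =>
    rw [replicate_succ, cons_add, Function.iterate_succ_apply', ← ih]
    refine relDegrees_cons_of_forall_not hr fun y hy ↦ (mem_add.mp hy).elim (fun hy ↦ ?_) (h y)
    rwa [eq_of_mem_replicate hy]

lemma card_iterate_dominate (p : ℕ) (X : Multiset ℕ) :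
    card (dominate^[p] X) = card X + p := by
  induction p with
  | zero => rfl
  | succ p ih => rw [Function.iterate_succ_apply', card_dominate, ih, add_assoc]

lemma sum_iterate_dominate (p : ℕ) (X : Multiset ℕ) :
    (dominate^[p] X).sum = X.sum + 2 * p * card X + p * (p - 1) := by
  induction p with
  | zero => simp
  | succ p ih =>
    rw [Function.iterate_succ_apply', dominate, sum_cons, sum_map_add, map_id', map_const',
      sum_replicate, card_iterate_dominate, ih]
    simp only [Nat.add_sub_cancel, smul_eq_mul, mul_one]
    cases p with
    | zero => ring
    | succ p => rw [Nat.add_sub_cancel]; ring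

lemma iterate_isolate (q : ℕ) (X : Multiset ℕ) : isolate^[q] X = replicate q 0 + X := by
  induction q with
  | zero => simp
  | succ q ih => rw [Function.iterate_succ_apply', ih, isolate, replicate_succ, cons_add]

lemma isLeast_iterate_dominate {X : Multiset ℕ} (hX : 0 ∈ X) (p : ℕ) :
    IsLeast {d | d ∈ dominate^[p] X} p := by
  induction p with
  | zero => exact ⟨hX, fun _ _ ↦ Nat.zero_le _⟩
  | succ p ih =>
    rw [Function.iterate_succ_apply']
    refine ⟨mem_cons_of_mem (mem_map_of_mem _ ih.1), fun d hd ↦ ?_⟩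
    obtain rfl | hd := mem_cons.mp hd
    · have := card_pos_iff_exists_mem.mpr ⟨0, hX⟩
      rw [card_iterate_dominate]
      lia
    · obtain ⟨e, he, rfl⟩ := mem_map.mp hd
      exact Nat.succ_le_succ (ih.2 he)

end RelDegrees

section TieLevels

open Multiset

variable {M : Multiset ℝ} {x t : ℝ} {p q : ℕ}

lemma tieLevels_cons_of_mem (h : -x ∈ M) : tieLevels (x ::ₘ M) = insert |x| (tieLevels M) := by
  ext s
  constructor
  · rintro ⟨y, hy, hneg, rfl⟩
    obtain rfl | hyx := eq_or_ne y x
    · exact .inl rfl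
    rw [erase_cons_tail_of_mem ((mem_cons.mp hy).resolve_left hyx)] at hneg
    obtain hneg | hneg := mem_cons.mp hneg
    · exact .inl (by rw [← hneg, abs_neg])
    · exact .inr ⟨y, (mem_cons.mp hy).resolve_left hyx, hneg, rfl⟩
  · rintro (rfl | ⟨y, hy, hneg, rfl⟩)
    · exact ⟨x, mem_cons_self x M, by rwa [erase_cons_head], rfl⟩
    · refine ⟨y, mem_cons_of_mem hy, ?_, rfl⟩
      rw [erase_cons_tail_of_mem hy]
      exact mem_cons_of_mem hneg

lemma tieLevels_cons_of_notMem (h : -x ∉ M) : tieLevels (x ::ₘ M) = tieLevels M := by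
  ext s
  constructor
  · rintro ⟨y, hy, hneg, rfl⟩
    obtain hyM | hyM := em (y ∈ M)
    · rw [erase_cons_tail_of_mem hyM] at hneg
      obtain hneg | hneg := mem_cons.mp hneg
      · exact (h (by rwa [← hneg, neg_neg])).elim
      · exact ⟨y, hyM, hneg, rfl⟩
    · obtain rfl := (mem_cons.mp hy).resolve_right hyM
      rw [erase_cons_head] at hneg
      exact (h hneg).elim
  · rintro ⟨y, hy, hneg, rfl⟩
    refine ⟨y, mem_cons_of_mem hy, ?_, rfl⟩
    rw [erase_cons_tail_of_mem hy]
    exact mem_cons_of_mem hneg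

lemma nonneg_of_mem_tieLevels (ht : t ∈ tieLevels M) : 0 ≤ t := by
  obtain ⟨x, -, -, rfl⟩ := ht
  exact abs_nonneg x

lemma mem_of_mem_tieLevels (ht : t ∈ tieLevels M) : t ∈ M ∧ -t ∈ M.erase t := by
  obtain ⟨x, hx, hneg, rfl⟩ := ht
  obtain h | h := abs_choice x <;> rw [h]
  · exact ⟨hx, hneg⟩
  · refine ⟨mem_of_mem_erase hneg, ?_⟩
    obtain h0 | h0 := eq_or_ne x (-x)
    · rw [← h0] at hneg ⊢
      rwa [← h0]
    · rwa [neg_neg, mem_erase_of_ne h0]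

lemma tieLevels_replicate_add_of_notMem (hx : x ≠ 0) (h : -x ∉ M) (p : ℕ) :
    tieLevels (replicate p x + M) = tieLevels M := by
  induction p with
  | zero => simp
  | succ p ih =>
    rw [replicate_succ, cons_add, tieLevels_cons_of_notMem, ih]
    intro hmem
    exact (mem_add.mp hmem).elim (fun hmem ↦ hx (neg_eq_self.mp (eq_of_mem_replicate hmem))) h

lemma tieLevels_replicate_add_of_mem (hp : p ≠ 0) (h : -x ∈ M) :
    tieLevels (replicate p x + M) = insert |x| (tieLevels M) := by
  induction p with
  | zero => exact (hp rfl).elim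
  | succ p ih =>
    rw [replicate_succ, cons_add, tieLevels_cons_of_mem (mem_add.mpr (.inr h))]
    obtain rfl | hp := eq_or_ne p 0
    · simp
    · rw [ih hp, Set.insert_idem]

/-- The weights `M` together with `p` weights `t` and `q` weights `-t`. -/
def addTie (p q : ℕ) (t : ℝ) (M : Multiset ℝ) : Multiset ℝ :=
  replicate p t + (replicate q (-t) + M)

lemma card_addTie (p q : ℕ) (t : ℝ) (M : Multiset ℝ) :
    card (addTie p q t M) = p + (q + card M) := by
  simp [addTie]

lemma tieLevels_addTie (hp : p ≠ 0) (hq : q ≠ 0) (ht : 0 < t) (hM : ∀ y ∈ M, |y| < t) :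
    tieLevels (addTie p q t M) = insert t (tieLevels M) := by
  have hmem : -t ∈ replicate q (-t) + M := mem_add.mpr (.inl (mem_replicate.mpr ⟨hq, rfl⟩))
  have hnotMem : -(-t) ∉ M := fun h ↦ (hM _ h).not_ge (by simp [le_abs_self])
  rw [addTie, tieLevels_replicate_add_of_mem hp hmem,
    tieLevels_replicate_add_of_notMem (neg_ne_zero.mpr ht.ne') hnotMem, abs_of_pos ht]

lemma eq_addTie_of_forall_abs_le (ht : 0 < t) (hM : ∀ y ∈ M, |y| ≤ t) :
    M = addTie (M.count t) (M.count (-t)) t (M.filter (|·| < t)) := by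
  ext y
  simp only [addTie, count_add, count_replicate, count_filter]
  obtain rfl | hyt := eq_or_ne t y
  · simp [abs_of_pos ht, ht.ne', neg_eq_self]
  obtain rfl | hyt' := eq_or_ne (-t) y
  · simp [abs_of_pos ht, hyt]
  simp only [hyt, hyt', if_false, zero_add]
  split_ifs with hlt
  · rfl
  · refine count_eq_zero.mpr fun hy ↦ ?_
    obtain rfl | rfl := eq_or_eq_neg_of_abs_eq ((hM y hy).antisymm (not_lt.mp hlt))
    · exact hyt rfl
    · exact hyt' rfl

lemma exists_forall_abs_lt (M : Multiset ℝ) : ∃ t, 0 < t ∧ ∀ y ∈ M, |y| < t := by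
  obtain rfl | hM := eq_or_ne M 0
  · exact ⟨1, one_pos, by simp⟩
  · obtain ⟨x, -, hx⟩ := exists_max_image (|·|) hM
    exact ⟨|x| + 1, by positivity, fun y hy ↦ (hx y hy).trans_lt (lt_add_one _)⟩

end TieLevels

section DegreePairs

open Multiset

noncomputable instance (T : Set ℝ) : DecidableRel (ThresholdRel T) :=
  fun _ _ ↦ Classical.dec _

variable {M : Multiset ℝ} {x : ℝ} {n : ℕ} {S : Set (Set ℝ)}

/-- The degrees of the two extreme threshold graphs of the weights `M`: all ties off, and all
ties on. -/
noncomputable def endpoints (M : Multiset ℝ) : Multiset ℕ × Multiset ℕ :=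
  (relDegrees (ThresholdRel ∅) M, relDegrees (ThresholdRel Set.univ) M)

/-- The endpoint pairs of `n` weights whose set of tie levels is an element of `S`. -/
def degreePairs (S : Set (Set ℝ)) (n : ℕ) : Set (Multiset ℕ × Multiset ℕ) :=
  endpoints '' {M | card M = n ∧ tieLevels M ∈ S}

/-- The endpoint pairs of `n` weights whose set of tie levels is an element of `S` and contains
the largest absolute value of the weights. -/
def outerTiePairs (S : Set (Set ℝ)) (n : ℕ) : Set (Multiset ℕ × Multiset ℕ) :=
  endpoints '' {M | card M = n ∧ tieLevels M ∈ S ∧ ∃ t ∈ tieLevels M, ∀ y ∈ M, |y| ≤ t}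

lemma card_of_mem_degreePairs {e : Multiset ℕ × Multiset ℕ} (he : e ∈ degreePairs S n) :
    card e.1 = n ∧ card e.2 = n := by
  obtain ⟨M, ⟨hM, -⟩, rfl⟩ := he
  exact ⟨(card_relDegrees _ M).trans hM, (card_relDegrees _ M).trans hM⟩

lemma thresholdRel_symm (T : Set ℝ) (x y : ℝ) : ThresholdRel T x y → ThresholdRel T y x :=
  ThresholdRel.symm

lemma endpoints_cons_of_pos (h : ∀ y ∈ M, 0 < x + y) :
    endpoints (x ::ₘ M) = Prod.map dominate dominate (endpoints M) :=
  Prod.ext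
    (relDegrees_cons_of_forall (thresholdRel_symm ∅) fun y hy ↦ .inl (h y hy))
    (relDegrees_cons_of_forall (thresholdRel_symm Set.univ) fun y hy ↦ .inl (h y hy))

lemma endpoints_cons_of_neg (h : ∀ y ∈ M, x + y < 0) :
    endpoints (x ::ₘ M) = Prod.map isolate isolate (endpoints M) :=
  Prod.ext
    (relDegrees_cons_of_forall_not (thresholdRel_symm ∅)
      fun y hy hxy ↦ (h y hy).not_ge hxy.add_nonneg)
    (relDegrees_cons_of_forall_not (thresholdRel_symm Set.univ)
      fun y hy hxy ↦ (h y hy).not_ge hxy.add_nonneg)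

lemma exists_eq_cons_of_not_outer_tie (hM : M ≠ 0)
    (h : ¬∃ t ∈ tieLevels M, ∀ y ∈ M, |y| ≤ t) :
    ∃ x N, M = x ::ₘ N ∧ -x ∉ N ∧ ((∀ y ∈ N, 0 < x + y) ∨ ∀ y ∈ N, x + y < 0) := by
  obtain ⟨x, hx, hmax⟩ := exists_max_image (|·|) hM
  obtain ⟨N, rfl⟩ := exists_cons_of_mem hx
  have hneg : -x ∉ N := fun hneg ↦ h ⟨|x|, ⟨x, hx, by rwa [erase_cons_head], rfl⟩, hmax⟩
  refine ⟨x, N, rfl, hneg, ?_⟩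
  have hne {y} (hy : y ∈ N) : x + y ≠ 0 := fun h0 ↦ hneg (eq_neg_of_add_eq_zero_right h0 ▸ hy)
  have habs {y} (hy : y ∈ N) : |y| ≤ |x| := hmax y (mem_cons_of_mem hy)
  obtain h0 | h0 := le_total 0 x
  · refine .inl fun y hy ↦ lt_of_le_of_ne ?_ (hne hy).symm
    linarith [neg_le_of_abs_le (abs_of_nonneg h0 ▸ habs hy)]
  · refine .inr fun y hy ↦ lt_of_le_of_ne ?_ (hne hy)
    linarith [le_of_abs_le (abs_of_nonpos h0 ▸ habs hy)]

lemma degreePairs_succ (S : Set (Set ℝ)) (n : ℕ) :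
    degreePairs S (n + 1) = Prod.map dominate dominate '' degreePairs S n ∪
      (Prod.map isolate isolate '' degreePairs S n ∪ outerTiePairs S (n + 1)) := by
  refine Set.Subset.antisymm ?_ (Set.union_subset ?_ (Set.union_subset ?_ ?_))
  · rintro _ ⟨M, ⟨hcard, hS⟩, rfl⟩
    by_cases houter : ∃ t ∈ tieLevels M, ∀ y ∈ M, |y| ≤ t
    · exact .inr (.inr ⟨M, ⟨hcard, hS, houter⟩, rfl⟩)
    obtain ⟨x, N, rfl, hneg, hsign⟩ :=
      exists_eq_cons_of_not_outer_tie (card_pos.mp (by lia)) houter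
    rw [card_cons, add_left_inj] at hcard
    rw [tieLevels_cons_of_notMem hneg] at hS
    obtain hpos | hneg := hsign
    · exact .inl ⟨_, ⟨N, ⟨hcard, hS⟩, rfl⟩, (endpoints_cons_of_pos hpos).symm⟩
    · exact .inr (.inl ⟨_, ⟨N, ⟨hcard, hS⟩, rfl⟩, (endpoints_cons_of_neg hneg).symm⟩)
  · rintro _ ⟨_, ⟨N, ⟨hcard, hS⟩, rfl⟩, rfl⟩
    obtain ⟨t, ht, hN⟩ := exists_forall_abs_lt N
    have hpos (y) (hy : y ∈ N) : 0 < t + y := by linarith [(abs_lt.mp (hN y hy)).1]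
    rw [← tieLevels_cons_of_notMem fun h ↦ (hpos _ h).ne' (add_neg_cancel t)] at hS
    exact ⟨t ::ₘ N, ⟨by rw [card_cons, hcard], hS⟩, endpoints_cons_of_pos hpos⟩
  · rintro _ ⟨_, ⟨N, ⟨hcard, hS⟩, rfl⟩, rfl⟩
    obtain ⟨t, ht, hN⟩ := exists_forall_abs_lt N
    have hneg (y) (hy : y ∈ N) : -t + y < 0 := by linarith [(abs_lt.mp (hN y hy)).2]
    rw [← tieLevels_cons_of_notMem fun h ↦ (hneg _ h).ne (add_neg_cancel (-t))] at hS
    exact ⟨-t ::ₘ N, ⟨by rw [card_cons, hcard], hS⟩, endpoints_cons_of_neg hneg⟩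
  · rintro _ ⟨M, ⟨hcard, hS, -⟩, rfl⟩
    exact ⟨M, ⟨hcard, hS⟩, rfl⟩

lemma zero_mem_of_mem_outerTiePairs {e : Multiset ℕ × Multiset ℕ} (he : e ∈ outerTiePairs S n) :
    0 ∈ e.1 ∧ 0 ∉ e.2 := by
  obtain ⟨M, ⟨-, -, t, ht, hmax⟩, rfl⟩ := he
  obtain ⟨htM, hneg⟩ := mem_of_mem_tieLevels ht
  constructor
  · refine mem_map.mpr ⟨-t, mem_of_mem_erase hneg, countP_eq_zero.mpr fun y hy hrel ↦ ?_⟩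
    have hpos : 0 < -t + y := hrel.resolve_right fun h ↦ h.2
    linarith [(abs_le.mp (hmax y (mem_of_mem_erase hy))).2]
  · intro h0
    obtain ⟨y, hy, hcount⟩ := mem_map.mp h0
    rw [countP_eq_zero] at hcount
    obtain rfl | hyt := eq_or_ne y t
    · exact hcount _ hneg (.inr ⟨add_neg_cancel y, trivial⟩)
    · have hge : 0 ≤ y + t := by linarith [(abs_le.mp (hmax y hy)).1]
      exact hcount t ((mem_erase_of_ne hyt.symm).mpr htM)
        (hge.lt_or_eq.imp id fun h ↦ ⟨h.symm, trivial⟩)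

lemma zero_notMem_dominate {X : Multiset ℕ} (hX : card X ≠ 0) : 0 ∉ dominate X := by
  simp [dominate, hX.symm]

lemma encard_degreePairs_add_two (S : Set (Set ℝ)) (n : ℕ) :
    (degreePairs S (n + 2)).encard =
      2 * (degreePairs S (n + 1)).encard + (outerTiePairs S (n + 2)).encard := by
  have hdom {e} (he : e ∈ Prod.map dominate dominate '' degreePairs S (n + 1)) : 0 ∉ e.1 := by
    obtain ⟨e, he, rfl⟩ := he
    exact zero_notMem_dominate (by simp [(card_of_mem_degreePairs he).1])
  have hiso {e} (he : e ∈ Prod.map isolate isolate '' degreePairs S (n + 1)) :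
      0 ∈ e.1 ∧ 0 ∈ e.2 := by
    obtain ⟨e, -, rfl⟩ := he
    exact ⟨mem_cons_self 0 _, mem_cons_self 0 _⟩
  rw [degreePairs_succ, Set.encard_union_eq, Set.encard_union_eq,
    (dominate_injective.prodMap dominate_injective).encard_image,
    (isolate_injective.prodMap isolate_injective).encard_image, ← add_assoc, two_mul]
  · exact Set.disjoint_left.mpr fun e he houter ↦
      (zero_mem_of_mem_outerTiePairs houter).2 (hiso he).2
  · exact Set.disjoint_left.mpr fun e he he' ↦ hdom he
      (he'.elim (fun he' ↦ (hiso he').1) fun he' ↦ (zero_mem_of_mem_outerTiePairs he').1)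

lemma tieLevels_zero : tieLevels 0 = ∅ :=
  Set.eq_empty_of_forall_notMem fun _ ⟨_, hx, _⟩ ↦ notMem_zero _ hx

lemma degreePairs_empty_zero : degreePairs {∅} 0 = {(0, 0)} := by
  have h : {M : Multiset ℝ | card M = 0 ∧ tieLevels M ∈ ({∅} : Set (Set ℝ))} = {0} := by
    ext M
    simp +contextual [tieLevels_zero]
  rw [degreePairs, h, Set.image_singleton]
  rfl

lemma outerTiePairs_empty (n : ℕ) : outerTiePairs {∅} n = ∅ := by
  refine Set.eq_empty_of_forall_notMem ?_
  rintro _ ⟨M, ⟨-, hM, t, ht, -⟩, -⟩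
  exact (Set.mem_singleton_iff.mp hM).subset ht

lemma encard_degreePairs_empty (n : ℕ) : (degreePairs {∅} n).encard = (2 ^ (n - 1) : ℕ) := by
  match n with
  | 0 => simp [degreePairs_empty_zero]
  | 1 =>
    simp [degreePairs_succ, degreePairs_empty_zero, outerTiePairs_empty, dominate, isolate]
  | n + 2 =>
    rw [encard_degreePairs_add_two, encard_degreePairs_empty (n + 1), outerTiePairs_empty]
    simp [pow_succ, mul_comm]

end DegreePairs

section UniqueTie

open Multiset

variable {M : Multiset ℝ} {t : ℝ} {m n p q p' q' : ℕ} {e e' : Multiset ℕ × Multiset ℕ}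

lemma fst_eq_snd_of_mem_degreePairs_empty (he : e ∈ degreePairs {∅} m) : e.1 = e.2 := by
  obtain ⟨M, ⟨-, hM⟩, rfl⟩ := he
  refine map_congr rfl fun x hx ↦ countP_congr rfl fun y hy ↦ propext ?_
  have h0 : x + y ≠ 0 := fun h0 ↦
    (Set.mem_singleton_iff.mp hM).subset ⟨x, hx, by rwa [← eq_neg_of_add_eq_zero_right h0], rfl⟩
  rw [thresholdRel_iff_of_add_ne_zero h0, thresholdRel_iff_of_add_ne_zero h0]

/-- The effect on an endpoint pair of surrounding the weights by an outermost tie between `p`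
positive and `q` negative weights: with the tie off, the negative ones are isolated; with the tie
on, the positive ones dominate. -/
def tiePair (p q : ℕ) (e : Multiset ℕ × Multiset ℕ) : Multiset ℕ × Multiset ℕ :=
  (isolate^[q] (dominate^[p] e.1), dominate^[p] (isolate^[q] e.2))

lemma endpoints_addTie (ht : 0 < t) (hM : ∀ y ∈ M, |y| < t) (p q : ℕ) :
    endpoints (addTie p q t M) = tiePair p q (endpoints M) := by
  have hdom (T : Set ℝ) (y) (hy : y ∈ M) : ThresholdRel T t y :=
    .inl (by linarith [(abs_lt.mp (hM y hy)).1])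
  have hiso (T : Set ℝ) (y) (hy : y ∈ M) : ¬ThresholdRel T (-t) y := fun h ↦ by
    linarith [h.add_nonneg, (abs_lt.mp (hM y hy)).2]
  have hdom_self (T : Set ℝ) : ThresholdRel T t t := .inl (add_pos ht ht)
  have hiso_self (T : Set ℝ) : ¬ThresholdRel T (-t) (-t) := fun h ↦ by linarith [h.add_nonneg]
  refine Prod.ext ?_ ?_
  · have hoff : ∀ y ∈ replicate p t + M, ¬ThresholdRel ∅ (-t) y := by
      intro y hy
      obtain hy | hy := mem_add.mp hy
      · rw [eq_of_mem_replicate hy, thresholdRel_iff_of_add_eq_zero (neg_add_cancel t)]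
        exact Set.notMem_empty _
      · exact hiso ∅ y hy
    rw [addTie, add_left_comm]
    exact (relDegrees_replicate_add_of_forall_not (thresholdRel_symm _) (hiso_self _) hoff q).trans
      (congrArg _ (relDegrees_replicate_add_of_forall (thresholdRel_symm _) (hdom_self _)
        (hdom _) p))
  · have hon : ∀ y ∈ replicate q (-t) + M, ThresholdRel Set.univ t y := by
      intro y hy
      obtain hy | hy := mem_add.mp hy
      · rw [eq_of_mem_replicate hy]
        exact .inr ⟨add_neg_cancel t, trivial⟩
      · exact hdom Set.univ y hy
    exact (relDegrees_replicate_add_of_forall (thresholdRel_symm _) (hdom_self _) hon p).trans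
      (congrArg _ (relDegrees_replicate_add_of_forall_not (thresholdRel_symm _) (hiso_self _)
        (hiso _) q))

lemma endpoints_replicate_zero (n : ℕ) :
    endpoints (replicate n 0) = (isolate^[n] 0, dominate^[n] 0) := by
  have hoff : ¬ThresholdRel ∅ 0 0 := by simp [ThresholdRel]
  have hon : ThresholdRel Set.univ 0 0 := by simp [ThresholdRel]
  have h0 (T : Set ℝ) : relDegrees (ThresholdRel T) 0 = 0 := rfl
  refine Prod.ext ?_ ?_
  · rw [endpoints, ← add_zero (replicate n 0),
      relDegrees_replicate_add_of_forall_not (thresholdRel_symm _) hoff (by simp), h0]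
  · rw [endpoints, ← add_zero (replicate n 0),
      relDegrees_replicate_add_of_forall (thresholdRel_symm _) hon (by simp), h0]

lemma tieLevels_replicate_zero (n : ℕ) : tieLevels (replicate (n + 2) 0) = {0} := by
  refine Set.eq_singleton_iff_unique_mem.mpr ⟨⟨0, ?_, ?_, abs_zero⟩, ?_⟩
  · exact mem_replicate.mpr ⟨by lia, rfl⟩
  · rw [neg_zero, replicate_succ, erase_cons_head]
    exact mem_replicate.mpr ⟨by lia, rfl⟩
  · rintro t ht
    exact eq_of_mem_replicate (mem_of_mem_tieLevels ht).1

lemma finite_degreePairs_empty (m : ℕ) : (degreePairs {∅} m).Finite :=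
  Set.finite_of_encard_eq_coe (encard_degreePairs_empty m)

/-- The data of a unique tie among `n + 2` weights at a nonzero outermost level: the number `m` of
weights inside the tie, one less than the number `p` of positive weights in the tie, and the
endpoint pair of the weights inside. -/
noncomputable def tieData (n : ℕ) : Finset ((_ : ℕ) × ℕ × Multiset ℕ × Multiset ℕ) :=
  (Finset.range (n + 1)).sigma fun m ↦
    Finset.range (n + 1 - m) ×ˢ (finite_degreePairs_empty m).toFinset

lemma mem_tieData {n : ℕ} {d : (_ : ℕ) × ℕ × Multiset ℕ × Multiset ℕ} :
    d ∈ tieData n ↔ d.1 + d.2.1 ≤ n ∧ d.2.2 ∈ degreePairs {∅} d.1 := by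
  simp only [tieData, Finset.mem_sigma, Finset.mem_product, Finset.mem_range,
    Set.Finite.mem_toFinset]
  grind

/-- The endpoint pair described by an element of `tieData n`. -/
def tieDataPair (n : ℕ) (d : (_ : ℕ) × ℕ × Multiset ℕ × Multiset ℕ) :
    Multiset ℕ × Multiset ℕ :=
  tiePair (d.2.1 + 1) (n + 1 - d.1 - d.2.1) d.2.2

lemma endpoints_mem_image_tieData (ht : 0 < t) (htM : t ∈ tieLevels M)
    (hties : tieLevels M ∈ Set.range singleton) (hmax : ∀ y ∈ M, |y| ≤ t) (hcard : card M = n + 2) :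
    endpoints M ∈ tieDataPair n '' (tieData n : Set _) := by
  obtain ⟨htmem, hneg⟩ := mem_of_mem_tieLevels htM
  obtain ⟨s, hs⟩ := hties
  obtain ⟨p, hp⟩ := Nat.exists_eq_add_of_lt (count_pos.mpr htmem)
  have hq := (count_pos.mpr (mem_of_mem_erase hneg)).ne'
  have hM := eq_addTie_of_forall_abs_le ht hmax
  set q := M.count (-t)
  set N := M.filter (|·| < t)
  have hN : ∀ y ∈ N, |y| < t := fun y hy ↦ (mem_filter.mp hy).2
  rw [hp, zero_add] at hM
  have hempty : tieLevels N = ∅ := by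
    rw [hM, tieLevels_addTie p.succ_ne_zero hq ht hN] at hs
    refine Set.eq_empty_of_forall_notMem fun r hr ↦ ?_
    have hrt : r = t := by
      rw [Set.mem_singleton_iff.mp (hs.symm.subset (.inr hr)),
        Set.mem_singleton_iff.mp (hs.symm.subset (.inl rfl))]
    exact ((le_abs_self r).trans_lt (hN r (mem_of_mem_tieLevels hr).1)).ne hrt
  have hcardN : p + 1 + (q + card N) = n + 2 := by rw [← card_addTie, ← hM, hcard]
  refine ⟨⟨card N, p, endpoints N⟩, mem_tieData.mpr ⟨by lia, N, ⟨rfl, hempty⟩, rfl⟩, ?_⟩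
  rw [hM, endpoints_addTie ht hN, tieDataPair, show n + 1 - card N - p = q by lia]

lemma tieDataPair_mem_outerTiePairs {d : (_ : ℕ) × ℕ × Multiset ℕ × Multiset ℕ}
    (hd : d ∈ tieData n) : tieDataPair n d ∈ outerTiePairs (Set.range singleton) (n + 2) := by
  obtain ⟨m, r, e⟩ := d
  obtain ⟨hle, N, ⟨hcard, hN⟩, rfl⟩ := mem_tieData.mp hd
  dsimp only at hle hcard
  obtain ⟨t, ht, hlt⟩ := exists_forall_abs_lt N
  have hties : tieLevels (addTie (r + 1) (n + 1 - m - r) t N) = {t} := by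
    rw [tieLevels_addTie r.succ_ne_zero (by lia) ht hlt, Set.mem_singleton_iff.mp hN,
      insert_empty_eq]
  refine ⟨_, ⟨?_, ⟨t, hties.symm⟩, t, hties ▸ rfl, fun y hy ↦ ?_⟩, endpoints_addTie ht hlt _ _⟩
  · rw [card_addTie]
    lia
  · simp only [addTie, mem_add, mem_replicate] at hy
    obtain ⟨-, rfl⟩ | ⟨-, rfl⟩ | hy := hy
    · exact (abs_of_pos ht).le
    · exact (abs_neg t ▸ abs_of_pos ht).le
    · exact (hlt y hy).le

lemma outerTiePairs_range_singleton (n : ℕ) :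
    outerTiePairs (Set.range singleton) (n + 2) =
      insert (isolate^[n + 2] 0, dominate^[n + 2] 0) (tieDataPair n '' (tieData n : Set _)) := by
  refine Set.Subset.antisymm ?_ (Set.insert_subset ?_ ?_)
  · rintro _ ⟨M, ⟨hcard, hties, t, ht, hmax⟩, rfl⟩
    obtain rfl | hpos := (nonneg_of_mem_tieLevels ht).eq_or_lt
    · left
      rw [← endpoints_replicate_zero,
        eq_replicate.mpr ⟨hcard, fun y hy ↦ abs_nonpos_iff.mp (hmax y hy)⟩]
    · exact .inr (endpoints_mem_image_tieData hpos ht hties hmax hcard)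
  · have hties := tieLevels_replicate_zero n
    refine ⟨replicate (n + 2) 0, ⟨card_replicate _ _, ⟨0, hties.symm⟩, 0, hties ▸ rfl, ?_⟩,
      endpoints_replicate_zero _⟩
    intro y hy
    rw [eq_of_mem_replicate hy, abs_zero]
  · rintro _ ⟨d, hd, rfl⟩
    exact tieDataPair_mem_outerTiePairs hd

lemma sum_tiePair_snd (he : e.1 = e.2) :
    (tiePair p q e).2.sum = (tiePair p q e).1.sum + 2 * p * q := by
  simp only [tiePair, iterate_isolate, sum_iterate_dominate, he, sum_add, sum_replicate, card_add,
    card_replicate, smul_zero]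
  ring

lemma isLeast_tiePair_snd (hq : q ≠ 0) (p : ℕ) (e : Multiset ℕ × Multiset ℕ) :
    IsLeast {d | d ∈ (tiePair p q e).2} p := by
  refine isLeast_iterate_dominate ?_ p
  rw [iterate_isolate]
  exact mem_add.mpr (.inl (mem_replicate.mpr ⟨hq, rfl⟩))

lemma tiePair_inj (hp : p ≠ 0) (hq : q ≠ 0) (hq' : q' ≠ 0) (he : e.1 = e.2) (he' : e'.1 = e'.2)
    (h : tiePair p q e = tiePair p' q' e') : p = p' ∧ q = q' ∧ e = e' := by
  obtain rfl : p = p' := (isLeast_tiePair_snd hq p e).unique (h ▸ isLeast_tiePair_snd hq' p' e')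
  have hsum : 2 * p * q = 2 * p * q' := by
    have hsum := sum_tiePair_snd (p := p) (q := q) he
    rw [h, sum_tiePair_snd he'] at hsum
    exact (add_left_cancel hsum).symm
  obtain rfl : q = q' := Nat.eq_of_mul_eq_mul_left (by positivity) hsum
  refine ⟨rfl, rfl, Prod.ext ?_ ?_⟩
  · exact dominate_injective.iterate p (isolate_injective.iterate q (congrArg Prod.fst h))
  · exact isolate_injective.iterate q (dominate_injective.iterate p (congrArg Prod.snd h))

lemma tiePair_ne_iterate (hq : q ≠ 0) (n : ℕ) :
    tiePair p q e ≠ (isolate^[n + 3] 0, dominate^[n + 3] 0) := by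
  intro h
  have hleast : IsLeast {d | d ∈ dominate^[n + 3] 0} (n + 2) :=
    isLeast_iterate_dominate (mem_singleton_self 0) (n + 2)
  obtain rfl : p = n + 2 := (isLeast_tiePair_snd hq p e).unique (by rwa [h])
  have hsum := congrArg (fun e ↦ e.1.sum) h
  simp only [tiePair, iterate_isolate, sum_add, sum_replicate, sum_iterate_dominate, smul_zero,
    sum_zero] at hsum
  have hpos : 0 < (n + 2) * (n + 2 - 1) := Nat.mul_pos (by lia) (by lia)
  exact hpos.ne' (by lia)

lemma sum_two_pow_pred (k : ℕ) : ∑ m ∈ Finset.range (k + 1), 2 ^ (m - 1) = 2 ^ k := by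
  induction k with
  | zero => rfl
  | succ k ih => rw [Finset.sum_range_succ, ih, Nat.add_sub_cancel, pow_succ, mul_two]

lemma sum_mul_two_pow_pred (k : ℕ) :
    ∑ m ∈ Finset.range (k + 1), (k + 1 - m) * 2 ^ (m - 1) + 1 = 2 ^ (k + 1) := by
  induction k with
  | zero => rfl
  | succ k ih =>
    have h : ∀ m ∈ Finset.range (k + 2), (k + 2 - m) * 2 ^ (m - 1) =
        (k + 1 - m) * 2 ^ (m - 1) + 2 ^ (m - 1) := by
      intro m hm
      rw [Finset.mem_range] at hm
      rw [show k + 2 - m = k + 1 - m + 1 by lia, add_mul, one_mul]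
    rw [Finset.sum_congr rfl h, Finset.sum_add_distrib, sum_two_pow_pred, Finset.sum_range_succ,
      Nat.sub_self, zero_mul, add_zero, add_right_comm, ih, pow_succ 2 (k + 1), mul_two]

lemma card_tieData (n : ℕ) : (tieData n).card + 1 = 2 ^ (n + 1) := by
  have hcard (m : ℕ) : (finite_degreePairs_empty m).toFinset.card = 2 ^ (m - 1) := by
    rw [← Nat.cast_inj (R := ℕ∞), ← (finite_degreePairs_empty m).encard_eq_coe_toFinset_card,
      encard_degreePairs_empty]
  simp only [tieData, Finset.card_sigma, Finset.card_product, Finset.card_range, hcard,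
    sum_mul_two_pow_pred]

lemma encard_outerTiePairs_range_singleton (n : ℕ) :
    (outerTiePairs (Set.range singleton) (n + 3)).encard = (2 ^ (n + 2) : ℕ) := by
  rw [outerTiePairs_range_singleton, Set.encard_insert_of_notMem, Set.InjOn.encard_image,
    Set.encard_coe_eq_coe_finsetCard, ← card_tieData]
  · rfl
  · rintro ⟨m, r, e⟩ hd ⟨m', r', e'⟩ hd' h
    obtain ⟨hle, he⟩ := mem_tieData.mp hd
    obtain ⟨hle', he'⟩ := mem_tieData.mp hd'
    dsimp only at hle he hle' he'
    obtain ⟨hr, -, rfl⟩ := tiePair_inj (by lia) (by lia) (by lia)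
      (fst_eq_snd_of_mem_degreePairs_empty he) (fst_eq_snd_of_mem_degreePairs_empty he') h
    obtain rfl : r = r' := Nat.succ_injective hr
    obtain rfl : m = m' :=
      (card_of_mem_degreePairs he).1.symm.trans (card_of_mem_degreePairs he').1
    rfl
  · rintro ⟨⟨m, r, e⟩, hd, h⟩
    have hle : m + r ≤ n + 1 := (mem_tieData.mp hd).1
    exact tiePair_ne_iterate (by lia) n h

lemma encard_degreePairs_range_singleton_two :
    (degreePairs (Set.range singleton) 2).encard = 1 := by
  have hone : degreePairs (Set.range singleton) 1 = ∅ := by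
    refine Set.eq_empty_of_forall_notMem ?_
    rintro _ ⟨M, ⟨hM, t, ht⟩, -⟩
    obtain ⟨x, rfl⟩ := card_eq_one.mp hM
    rw [← cons_zero, tieLevels_cons_of_notMem (notMem_zero _), tieLevels_zero] at ht
    exact Set.singleton_ne_empty t ht
  have hall : tieDataPair 0 '' (tieData 0 : Set _) ⊆ {(isolate^[2] 0, dominate^[2] 0)} := by
    rintro _ ⟨⟨m, r, e⟩, hd, rfl⟩
    obtain ⟨hle, he⟩ := mem_tieData.mp hd
    obtain ⟨rfl, rfl⟩ : m = 0 ∧ r = 0 := Nat.add_eq_zero_iff.mp (Nat.le_zero.mp hle)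
    obtain rfl : e = (0, 0) := degreePairs_empty_zero.subset he
    rfl
  have houter : outerTiePairs (Set.range singleton) 2 = {(isolate^[2] 0, dominate^[2] 0)} := by
    rw [outerTiePairs_range_singleton]
    exact (Set.insert_subset (Set.mem_singleton _) hall).antisymm
      (Set.singleton_subset_iff.mpr (Set.mem_insert _ _))
  rw [encard_degreePairs_add_two, hone, houter, Set.encard_empty, mul_zero, zero_add,
    Set.encard_singleton]

lemma encard_degreePairs_range_singleton (n : ℕ) :
    (degreePairs (Set.range singleton) (n + 2)).encard = (2 ^ n * (2 * n + 1) : ℕ) := by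
  induction n with
  | zero => exact encard_degreePairs_range_singleton_two
  | succ n ih =>
    rw [encard_degreePairs_add_two, ih, encard_outerTiePairs_range_singleton]
    norm_cast
    ring

end UniqueTie

section Count

open Multiset

variable {n : ℕ}

open Classical in
lemma map_thresholdVertex {V : Type*} [Fintype V] (a : V → ℝ) (T : Set ℝ) :
    Finset.univ.val.map (thresholdVertex a T) =
      (relDegrees (ThresholdRel T) (Finset.univ.val.map a)).map Nat.cast := by
  rw [relDegrees, map_map, map_map]
  refine map_congr rfl fun i hi ↦ congrArg Nat.cast ?_
  suffices h : (thresholdGraph a T).neighborFinset i =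
      (Finset.univ.erase i).filter fun j ↦ ThresholdRel T (a i) (a j) by
    change _ = ((Finset.univ.val.map a).erase (a i)).countP (ThresholdRel T (a i))
    rw [← map_erase_of_mem a _ hi, countP_map, ← SimpleGraph.card_neighborFinset_eq_degree, h]
    rfl
  ext j
  rw [SimpleGraph.mem_neighborFinset]
  simp [thresholdGraph, eq_comm]

lemma injOn_map_univ_val :
    Set.InjOn (fun a : Fin n → ℝ ↦ Finset.univ.val.map a) {a | Antitone a} := by
  intro a ha b hb h
  simp only [Fin.univ_val_map, coe_eq_coe] at h
  exact List.ofFn_injective (h.eq_of_pairwise' ha.sortedGE_ofFn.pairwise hb.sortedGE_ofFn.pairwise)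

lemma exists_antitone_map_univ_val_eq {M : Multiset ℝ} (hM : card M = n) :
    ∃ a : Fin n → ℝ, Antitone a ∧ Finset.univ.val.map a = M := by
  subst hM
  rw [← length_sort (s := M) (r := (· ≥ ·))]
  refine ⟨(M.sort (· ≥ ·)).get, ?_, ?_⟩
  · exact (pairwise_sort M (· ≥ ·)).sortedGE.antitone_get
  · rw [Fin.univ_val_map, List.ofFn_get, sort_eq]

lemma ncard_polytopeEdges_degreePartitionPolytope (n : ℕ) :
    (polytopeEdges (degreePartitionPolytope n)).ncard =
      (degreePairs (Set.range singleton) n).ncard := by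
  set A := {a : Fin n → ℝ | Antitone a ∧ tieLevels (Finset.univ.val.map a) ∈ Set.range singleton}
  let vertices (a : Fin n → ℝ) := (thresholdVertex a ∅, thresholdVertex a Set.univ)
  let values (x : Fin n → ℝ) := Finset.univ.val.map x
  let cast (e : Multiset ℕ × Multiset ℕ) : Multiset ℝ × Multiset ℝ :=
    Prod.map (Multiset.map Nat.cast) (Multiset.map Nat.cast) e
  have hedges : (vertices '' A).ncard = (polytopeEdges (degreePartitionPolytope n)).ncard := by
    have hinj : Set.InjOn (fun e ↦ segment ℝ e.1 e.2) (vertices '' A) := by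
      refine segment_injOn_le.mono ?_
      rintro _ ⟨a, -, rfl⟩
      exact thresholdVertex_mono a (Set.empty_subset _)
    rw [polytopeEdges_degreePartitionPolytope, ← hinj.ncard_image, Set.image_image]
  have hvalues : Set.InjOn (Prod.map values values) (vertices '' A) := by
    refine (injOn_map_univ_val.prodMap injOn_map_univ_val).mono ?_
    rintro _ ⟨a, ⟨ha, -⟩, rfl⟩
    exact ⟨antitone_thresholdVertex ha _, antitone_thresholdVertex ha _⟩
  have hcast : Function.Injective cast :=
    (map_injective Nat.cast_injective).prodMap (map_injective Nat.cast_injective)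
  have hweights : values '' A = {M | card M = n ∧ tieLevels M ∈ Set.range singleton} := by
    ext M
    constructor
    · rintro ⟨a, ⟨-, hties⟩, rfl⟩
      exact ⟨by simp [values], hties⟩
    · rintro ⟨hM, hties⟩
      obtain ⟨a, ha, rfl⟩ := exists_antitone_map_univ_val_eq hM
      exact ⟨a, ⟨ha, hties⟩, rfl⟩
  have hcommute (a : Fin n → ℝ) :
      Prod.map values values (vertices a) = cast (endpoints (values a)) :=
    Prod.ext (map_thresholdVertex a ∅) (map_thresholdVertex a Set.univ)
  rw [← hedges, ← hvalues.ncard_image, Set.image_image, degreePairs, ← hweights, Set.image_image,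
    ← Set.ncard_image_of_injective _ hcast, Set.image_image]
  simp only [hcommute]

end Count

theorem mainTheorem5 (n : ℕ) (hn : 3 ≤ n) :
    (polytopeEdges (degreePartitionPolytope n)).ncard = 2 ^ (n - 2) * (2 * n - 3) := by
  obtain ⟨k, rfl⟩ := Nat.exists_eq_add_of_le' (Nat.le_of_succ_le hn)
  rw [ncard_polytopeEdges_degreePartitionPolytope, Set.ncard,
    encard_degreePairs_range_singleton, ENat.toNat_natCast,
    Nat.add_sub_cancel, show 2 * (k + 2) - 3 = 2 * k + 1 by lia]
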